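/- Let $R>0$, $\beta>0$ and $\tilde q=e^{-2\pi/\beta}$, and let $\eta(q)=q^{1/24}\prod_{k\ge1}(1-q^k)$. Consider the free boson on the circle of radius $R$, with space of states spanned by the orthogonal Fock modules built on orthonormal oscillator ground states $|p,w\rangle$ with momentum $p=m/R$ and winding number $w$ ($m,w\in\mathbb Z$); the left and right oscillators satisfy $[a_k,a_l]=[\tilde a_k,\tilde a_l]=k\,\delta_{k+l,0}$, $[a_k,\tilde a_l]=0$, $a_k^\dagger=a_{-k}$, $\tilde a_k^\dagger=\tilde a_{-k}$, and $a_k,\tilde a_k$ with $k\ge 1$ annihilate the ground states. Let $$H_\beta=\frac{2\pi}{\beta}\Big[(R\hat w)^2+(\hat p/2)^2+\sum_{k\ge1}a_{-k}a_k+\sum_{k\ge1}\tilde a_{-k}\tilde a_k-\tfrac1{12}\Big],$$ and for $n,m\in\mathbb Z$ define the (formal, non-normalizable) Neumann and Dirichlet Ishibashi states $$|\iota^N_{nR}\rangle=e^{-\sum_{k\ge1}a_{-k}\tilde a_{-k}/k}\,|p=0,\,w=n\rangle,\qquad |\iota^D_{m/2R}\rangle=e^{\sum_{k\ge1}a_{-k}\tilde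 a_{-k}/k}\,|p=m/R,\,w=0\rangle .$$ Then for all $n,m\in\mathbb Z$ the following inner products converge (absolutely, as sums over the orthonormal occupation-number basis) and $$\langle\iota^N_{nR}|e^{-H_\beta/2}|\iota^N_{mR}\rangle=\frac{\tilde q^{R^2n^2/2}}{\eta(\tilde q)}\,\delta_{n,m},\qquad \langle\iota^D_{n/2R}|e^{-H_\beta/2}|\iota^D_{m/2R}\rangle=\frac{\tilde q^{n^2/8R^2}}{\eta(\tilde q)}\,\delta_{n,m},$$ $$\langle\iota^N_{nR}|e^{-H_\beta/2}|\iota^D_{m/2R}\rangle=\tilde q^{-1/24}\prod_{k\ge1}\frac1{1+\tilde q^k}\;\delta_{n,0}\delta_{m,0}=\frac{\sum_{k\in\mathbb Z}(-1)^k\tilde q^{k^2}}{\eta(\tilde q)}\;\delta_{n,0}\delta_{m,0}.$$ -/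

import Mathlib

open scoped ComplexConjugate

noncomputable section

namespace TorusModel

/-- Labels of the orthonormal occupation-number basis of
`⨁_{m, w ∈ ℤ} F_{m/2R + wR} ⊗ F_{m/2R - wR}`.  The vector with label `(m, w, left, right)` is the
normalized multiple of `∏ₖ (a₋ₖ)^(left k) ∏ₖ (ã₋ₖ)^(right k) |p = m/R, w⟩`, where `[aₖ, a₋ₖ] = k`. -/
@[ext] structure Label where
  /-- the integer `m`; the momentum is `p = m / R` -/
  mom : ℤ
  /-- the winding number, i.e. the eigenvalue of `ŵ` -/
  wind : ℤ
  /-- occupation numbers of the left-moving modes `k = 1, 2, …` -/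
  left : ℕ+ →₀ ℕ
  /-- occupation numbers of the right-moving modes `k = 1, 2, …` -/
  right : ℕ+ →₀ ℕ

/-- Formal (not necessarily normalizable) states: arbitrary families of coordinates in the
occupation-number basis, with the topology of coordinatewise convergence.  The Hilbert space of the
model is the subspace of the square-summable families. -/
abbrev FormalState := Label → ℂ

open Classical in
/-- The oscillator ground state `|p = m/R, w⟩`. -/
def ket (m w : ℤ) : FormalState := Pi.single ⟨m, w, 0, 0⟩ 1

/-- The left-moving creation operator `a₋ₖ`.  For `left k = 0` the square root vanishes. -/
def leftCreate (k : ℕ+) (ψ : FormalState) : FormalState := fun s =>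
  (√((k : ℝ) * s.left k) : ℂ) * ψ { s with left := s.left - Finsupp.single k 1 }

/-- The left-moving annihilation operator `aₖ`. -/
def leftAnnihilate (k : ℕ+) (ψ : FormalState) : FormalState := fun s =>
  (√((k : ℝ) * (s.left k + 1)) : ℂ) * ψ { s with left := s.left + Finsupp.single k 1 }

/-- The right-moving creation operator `ã₋ₖ`. -/
def rightCreate (k : ℕ+) (ψ : FormalState) : FormalState := fun s =>
  (√((k : ℝ) * s.right k) : ℂ) * ψ { s with right := s.right - Finsupp.single k 1 }

/-- The right-moving annihilation operator `ãₖ`. -/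
def rightAnnihilate (k : ℕ+) (ψ : FormalState) : FormalState := fun s =>
  (√((k : ℝ) * (s.right k + 1)) : ℂ) * ψ { s with right := s.right + Finsupp.single k 1 }

/-- The operator `p̂ / 2`. -/
def halfMomentum (R : ℝ) (ψ : FormalState) : FormalState := fun s =>
  ((s.mom / (2 * R) : ℝ) : ℂ) * ψ s

/-- The operator `R ŵ`. -/
def radiusWinding (R : ℝ) (ψ : FormalState) : FormalState := fun s =>
  ((R * s.wind : ℝ) : ℂ) * ψ s

/-- The closed string Hamiltonian
`H_β = (2π/β) [(R ŵ)² + (p̂/2)² + ∑ₖ a₋ₖ aₖ + ∑ₖ ã₋ₖ ãₖ - 1/12]`.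
Each coordinate of the two sums has finitely many nonzero terms. -/
def hamiltonian (R β : ℝ) (ψ : FormalState) : FormalState :=
  ((2 * Real.pi / β : ℝ) : ℂ) •
    (radiusWinding R (radiusWinding R ψ) + halfMomentum R (halfMomentum R ψ)
      + (∑' k : ℕ+, leftCreate k (leftAnnihilate k ψ))
      + (∑' k : ℕ+, rightCreate k (rightAnnihilate k ψ))
      - (1 / 12 : ℂ) • ψ)

/-- The exponential `e^A ψ = ∑ⱼ Aʲ ψ / j!` of an operator, as a coordinatewise convergent series. -/
def expOp (A : FormalState → FormalState) (ψ : FormalState) : FormalState :=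
  ∑' j : ℕ, ((Nat.factorial j : ℂ)⁻¹) • (A^[j]) ψ

/-- The operator `∑ₖ a₋ₖ ã₋ₖ / k`.  Each coordinate of the sum has finitely many nonzero terms. -/
def pairCreate (ψ : FormalState) : FormalState :=
  ∑' k : ℕ+, ((k : ℂ)⁻¹) • leftCreate k (rightCreate k ψ)

/-- The Neumann Ishibashi state `exp(-∑ₖ a₋ₖ ã₋ₖ / k) |p = 0, w = n⟩`, of charge `R w = n R`. -/
def neumannState (n : ℤ) : FormalState := expOp (fun ψ => -pairCreate ψ) (ket 0 n)

/-- The Dirichlet Ishibashi state `exp(∑ₖ a₋ₖ ã₋ₖ / k) |p = m/R, w = 0⟩`, of charge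
`p / 2 = m / 2R`. -/
def dirichletState (m : ℤ) : FormalState := expOp pairCreate (ket m 0)

/-- The operator `e^{-H_β / 2}`. -/
def propagator (R β : ℝ) : FormalState → FormalState :=
  expOp (fun ψ => (-(1 / 2) : ℂ) • hamiltonian R β ψ)

/-- `⟨φ| T |ψ⟩` exists (the sum over the orthonormal basis converges absolutely) and equals `z`. -/
def HasMatrixElement (φ : FormalState) (T : FormalState → FormalState) (ψ : FormalState) (z : ℂ) :
    Prop :=
  HasSum (fun s : Label => conj (φ s) * T ψ s) z

/-- The eta function `η(q) = q^(1/24) ∏ₙ (1 - qⁿ)`, as a function of the nome `q = e^{2πiτ}`. -/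
def etaNome (q : ℝ) : ℂ := ModularForm.eta (Complex.log q / (2 * Real.pi * Complex.I))

end TorusModel

end

/-!
In the occupation-number basis the Hamiltonian is diagonal, and every power of `∑ₖ a₋ₖ ã₋ₖ / k`
maps `|m/R, w⟩` to a multiple of the sum of the vectors `|m/R, w; l, l⟩` over the occupation
numbers `l` of a given total degree `|l|`. Hence
`exp(ε ∑ₖ a₋ₖ ã₋ₖ / k) |m/R, w⟩ = ∑ₗ ε^|l| |m/R, w; l, l⟩`, and the matrix element of `e^{-H_β/2}`
between two such states with parameters `ε` and `δ` is a zero-mode factor times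
`∑ₗ ∏ₖ (ε̄ δ q̃ᵏ)^{lₖ} = ∏ₖ (1 - ε̄ δ q̃ᵏ)⁻¹`. This product is the inverse
Euler product when both boundary conditions agree and `∏ₖ (1 + q̃ᵏ)⁻¹` when they differ.
The theta quotient for the latter is Gauss's identity `∑ (-1)^k q^(k²) = ∏ (1 - qᵏ) / (1 + qᵏ)`,
obtained as the limit of the finite identity of Shanks, which telescopes.
-/

section ProductExpansion

open Filter Topology Finset

lemma sum_finsupp_prod_eq_prod_sum {ι α R : Type*} [Zero α] [CommSemiring R] (S : Finset ι)
    (t : ι → Finset α) (f : ι → α → R) :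
    ∑ l ∈ S.finsupp t, ∏ k ∈ S, f k (l k) = ∏ k ∈ S, ∑ a ∈ t k, f k a := by
  classical
  rw [Finset.finsupp, sum_map, prod_sum]
  refine sum_congr rfl fun l _ => ?_
  rw [← prod_attach]
  exact prod_congr rfl fun k _ => by simp [Finsupp.indicator_of_mem k.2]

variable {ι : Type*}

lemma summable_finsupp_prod_pow_of_nonneg {x : ι → ℝ} (h0 : ∀ k, 0 ≤ x k) (h1 : ∀ k, x k < 1)
    (hs : Summable x) : Summable fun l : ι →₀ ℕ => l.prod fun k n => x k ^ n := by
  classical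
  have hnorm : Summable fun k => ‖-x k‖ := by simpa using hs.abs
  have hne : ∀ k, 1 + -x k ≠ 0 := fun k => by linarith [h1 k]
  obtain ⟨C, -, S₀, hC⟩ := ((multipliable_one_add_of_summable hnorm).inv₀
    (tprod_one_add_ne_zero_of_summable hne hnorm)).eventually_bounded_finsetProd
  refine summable_of_sum_le (c := C) (fun l => prod_nonneg fun k _ => pow_nonneg (h0 k) _)
    fun T => ?_
  set S := S₀ ∪ T.biUnion Finsupp.support
  set values : ι → Finset ℕ := fun k => T.image fun l => l k
  have hsupp : ∀ l ∈ T, l.support ⊆ S := fun l hl =>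
    (subset_biUnion_of_mem Finsupp.support hl).trans subset_union_right
  have hT : T ⊆ S.finsupp values := fun l hl =>
    mem_finsupp_iff.2 ⟨hsupp l hl, fun _ _ => mem_image_of_mem _ hl⟩
  calc ∑ l ∈ T, l.prod (fun k n => x k ^ n)
      = ∑ l ∈ T, ∏ k ∈ S, x k ^ l k := sum_congr rfl fun l hl =>
        l.prod_of_support_subset (hsupp l hl) _ fun k _ => pow_zero (x k)
    _ ≤ ∑ l ∈ S.finsupp values, ∏ k ∈ S, x k ^ l k :=
        sum_le_sum_of_subset_of_nonneg hT fun _ _ _ => prod_nonneg fun k _ => pow_nonneg (h0 k) _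
    _ = ∏ k ∈ S, ∑ n ∈ values k, x k ^ n := sum_finsupp_prod_eq_prod_sum S values _
    _ ≤ ∏ k ∈ S, (1 + -x k)⁻¹ := by
        refine prod_le_prod (fun k _ => sum_nonneg fun n _ => pow_nonneg (h0 k) n) fun k _ => ?_
        rw [← sub_eq_add_neg]
        exact sum_le_hasSum _ (fun n _ => pow_nonneg (h0 k) n)
          (hasSum_geometric_of_lt_one (h0 k) (h1 k))
    _ ≤ C := hC S subset_union_left

variable {R : Type*} [NormedCommRing R] [NormOneClass R] {x : ι → R}

lemma norm_finsupp_prod_pow_le (x : ι → R) (l : ι →₀ ℕ) :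
    ‖l.prod fun k n => x k ^ n‖ ≤ l.prod fun k n => ‖x k‖ ^ n :=
  (Finset.norm_prod_le _ _).trans
    (prod_le_prod (fun _ _ => norm_nonneg _) fun _ _ => norm_pow_le _ _)

variable [CompleteSpace R]

lemma summable_finsupp_prod_pow (hx : ∀ k, ‖x k‖ < 1) (hs : Summable fun k => ‖x k‖) :
    Summable fun l : ι →₀ ℕ => l.prod fun k n => x k ^ n :=
  (summable_finsupp_prod_pow_of_nonneg (fun _ => norm_nonneg _) hx hs).of_norm_bounded
    (norm_finsupp_prod_pow_le x)

/-- The part of the sum of all monomials `∏ₖ xₖ ^ lₖ` in which no variable from `S` occurs. -/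
noncomputable def tsumMonomialAvoiding (x : ι → R) (S : Finset ι) : R :=
  ∑' l : ι →₀ ℕ, {l : ι →₀ ℕ | ∀ k ∈ S, l k = 0}.indicator (fun l => l.prod fun k n => x k ^ n) l

/- A monomial avoiding `S` either avoids `a` as well or is `x a` times a monomial avoiding `S`. -/
lemma tsumMonomialAvoiding_insert [DecidableEq ι] (hx : ∀ k, ‖x k‖ < 1)
    (hs : Summable fun k => ‖x k‖) {a : ι} {S : Finset ι} (ha : a ∉ S) :
    tsumMonomialAvoiding x (insert a S) = (1 - x a) * tsumMonomialAvoiding x S := by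
  have hsum := summable_finsupp_prod_pow hx hs
  set f := fun l : ι →₀ ℕ => l.prod fun k n => x k ^ n
  set A := {l : ι →₀ ℕ | ∀ k ∈ S, l k = 0}
  set B := {l : ι →₀ ℕ | l a = 0}
  have hf : ∀ l, f (l + Finsupp.single a 1) = x a * f l := fun l => by
    simp only [f]
    rw [Finsupp.prod_add_index' (by simp) (fun _ _ _ => pow_add _ _ _),
      Finsupp.prod_single_index (h := fun k n => x k ^ n) (pow_zero _), pow_one, mul_comm]
  have hdvd : ∑' l, (A ∩ Bᶜ).indicator f l = x a * ∑' l, A.indicator f l := by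
    rw [← (add_left_injective (Finsupp.single a 1)).tsum_eq, ← (hsum.indicator A).tsum_mul_left]
    · refine tsum_congr fun l => ?_
      have : l + Finsupp.single a 1 ∈ A ∩ Bᶜ ↔ l ∈ A := by
        simp only [A, B, Set.mem_inter_iff, Set.mem_compl_iff, Set.mem_ofPred_eq]
        have hne : ∀ k ∈ S, Finsupp.single a 1 k = 0 := fun k hk =>
          Finsupp.single_eq_of_ne (ne_of_mem_of_not_mem hk ha)
        simp +contextual [hne]
      simp [Set.indicator_apply, this, hf]
    · intro l hl
      have hla : l a ≠ 0 := (Set.mem_of_indicator_ne_zero hl).2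
      exact ⟨l - Finsupp.single a 1, Finsupp.sub_add_single_one_cancel hla⟩
  have hins : {l : ι →₀ ℕ | ∀ k ∈ insert a S, l k = 0} = A ∩ B := by
    ext l
    simp [A, B, and_comm]
  rw [tsumMonomialAvoiding, hins, one_sub_mul, tsumMonomialAvoiding, ← hdvd, eq_sub_iff_add_eq,
    ← (hsum.indicator _).tsum_add (hsum.indicator _)]
  refine tsum_congr fun l => ?_
  change _ = A.indicator f l
  by_cases l ∈ A <;> by_cases l ∈ B <;> simp [*]

lemma tsumMonomialAvoiding_eq_prod_mul (hx : ∀ k, ‖x k‖ < 1) (hs : Summable fun k => ‖x k‖)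
    (S : Finset ι) : tsumMonomialAvoiding x S =
      (∏ k ∈ S, (1 - x k)) * ∑' l : ι →₀ ℕ, l.prod fun k n => x k ^ n := by
  classical
  induction S using Finset.induction_on with
  | empty => simp [tsumMonomialAvoiding]
  | insert a S ha ih => rw [tsumMonomialAvoiding_insert hx hs ha, ih, prod_insert ha, mul_assoc]

lemma tendsto_tsumMonomialAvoiding (hx : ∀ k, ‖x k‖ < 1) (hs : Summable fun k => ‖x k‖) :
    Tendsto (tsumMonomialAvoiding x) atTop (𝓝 1) := by
  classical
  have hlim : ∑' l : ι →₀ ℕ, (if l = 0 then 1 else 0 : R) = 1 := tsum_ite_eq 0 1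
  rw [← hlim]
  refine tendsto_tsum_of_dominated_convergence
    (summable_finsupp_prod_pow_of_nonneg (fun _ => norm_nonneg _) hx hs) (fun l => ?_)
    (.of_forall fun S l => (norm_indicator_le_norm_self _ _).trans (norm_finsupp_prod_pow_le x l))
  refine tendsto_const_nhds.congr' ((eventually_ge_atTop l.support).mono fun S hS => ?_)
  have : (∀ k ∈ S, l k = 0) ↔ l = 0 := by
    simp only [DFunLike.ext_iff, Finsupp.zero_apply]
    exact ⟨fun h k => by_contra fun hk => hk (h k (hS (Finsupp.mem_support_iff.2 hk))),
      fun h k _ => h k⟩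
  by_cases h : l = 0 <;> simp [this, h]

theorem tprod_one_sub_mul_tsum_finsupp_prod_pow (hx : ∀ k, ‖x k‖ < 1)
    (hs : Summable fun k => ‖x k‖) :
    (∏' k, (1 - x k)) * ∑' l : ι →₀ ℕ, l.prod (fun k n => x k ^ n) = 1 := by
  have hprod : HasProd (fun k => 1 - x k) (∏' k, (1 - x k)) := by
    simpa only [sub_eq_add_neg] using
      (multipliable_one_add_of_summable (f := fun k => -x k) (by simpa using hs)).hasProd
  refine tendsto_nhds_unique ?_ (tendsto_tsumMonomialAvoiding hx hs)
  rw [funext (tsumMonomialAvoiding_eq_prod_mul hx hs)]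
  exact (by simpa [HasProd] using hprod : Tendsto _ atTop _).mul_const _

theorem hasSum_finsupp_prod_pow {𝕜 : Type*} [NormedField 𝕜] [CompleteSpace 𝕜] {x : ι → 𝕜}
    (hx : ∀ k, ‖x k‖ < 1) (hs : Summable fun k => ‖x k‖) :
    HasSum (fun l : ι →₀ ℕ => l.prod fun k n => x k ^ n) (∏' k, (1 - x k))⁻¹ := by
  rw [← eq_inv_of_mul_eq_one_right (tprod_one_sub_mul_tsum_finsupp_prod_pow hx hs)]
  exact (summable_finsupp_prod_pow hx hs).hasSum

end ProductExpansion

section GaussIdentity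

open Filter Topology Finset

section Algebra

variable {K : Type*} [Field K] {q : K}

/-- The partial product `∏_{1 ≤ j ≤ n} (1 - q ^ j) / (1 + q ^ j)`, whose limit is the product
side of Gauss's theta identity. -/
def gaussProd (q : K) (n : ℕ) : K :=
  ∏ j ∈ range n, (1 - q ^ (j + 1)) / (1 + q ^ (j + 1))

/-- The terms of Shanks' finite form of Gauss's theta identity; the term `s = 0` is the partial
product itself, and every other term tends to zero as `n → ∞`. -/
def shanksTerm (q : K) (n s : ℕ) : K :=
  (-1) ^ s * (2 / (1 + q ^ s)) * q ^ (s * (n + 1)) * (gaussProd q n / gaussProd q s)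

lemma gaussProd_succ (q : K) (n : ℕ) :
    gaussProd q (n + 1) = gaussProd q n * ((1 - q ^ (n + 1)) / (1 + q ^ (n + 1))) :=
  prod_range_succ _ _

lemma gaussProd_ne_zero (hsub : ∀ j, 1 - q ^ (j + 1) ≠ 0) (hadd : ∀ j, 1 + q ^ j ≠ 0) (n : ℕ) :
    gaussProd q n ≠ 0 :=
  prod_ne_zero_iff.2 fun j _ => div_ne_zero (hsub j) (hadd (j + 1))

lemma shanksTerm_zero (hadd : ∀ j, 1 + q ^ j ≠ 0) (n : ℕ) : shanksTerm q n 0 = gaussProd q n := by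
  have h2 : (1 + 1 : K) ≠ 0 := by simpa using hadd 0
  simp [shanksTerm, gaussProd, ← one_add_one_eq_two, h2]

lemma sum_shanksTerm_succ_sub (hsub : ∀ j, 1 - q ^ (j + 1) ≠ 0) (hadd : ∀ j, 1 + q ^ j ≠ 0)
    (n m : ℕ) :
    ∑ s ∈ range (m + 1), (shanksTerm q (n + 1) s - shanksTerm q n s) =
      (-1) ^ (m + 1) * 2 * q ^ ((m + 1) * (n + 1)) * (gaussProd q n / gaussProd q m) /
        (1 + q ^ (n + 1)) := by
  have hn := hadd (n + 1)
  induction m with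
  | zero =>
    simp only [zero_add, sum_range_one, shanksTerm_zero hadd, gaussProd_succ]
    simp only [gaussProd, range_zero, prod_empty]
    field_simp
    ring
  | succ m ih =>
    have hm := gaussProd_ne_zero hsub hadd m
    have hms := hsub m
    have hma := hadd (m + 1)
    rw [sum_range_succ, ih]
    simp only [shanksTerm, gaussProd_succ]
    rw [mul_add_one (m + 1) (n + 1), add_one_mul (m + 1) (n + 1),
      pow_add q ((m + 1) * (n + 1)), pow_add q ((m + 1) * (n + 1)), pow_succ (-1 : K) (m + 1)]
    generalize q ^ ((m + 1) * (n + 1)) = x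
    generalize q ^ (m + 1) = y at *
    generalize q ^ (n + 1) = z at *
    field_simp
    ring

lemma sum_shanksTerm (hsub : ∀ j, 1 - q ^ (j + 1) ≠ 0) (hadd : ∀ j, 1 + q ^ j ≠ 0) (n : ℕ) :
    ∑ s ∈ range (n + 1), shanksTerm q n s =
      1 + 2 * ∑ s ∈ range n, (-1) ^ (s + 1) * q ^ ((s + 1) ^ 2) := by
  induction n with
  | zero => simp [shanksTerm_zero hadd, gaussProd]
  | succ n ih =>
    have htel := sum_shanksTerm_succ_sub hsub hadd n n
    rw [sum_sub_distrib, sub_eq_iff_eq_add] at htel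
    rw [sum_range_succ, htel, ih, sum_range_succ _ n, shanksTerm,
      div_self (gaussProd_ne_zero hsub hadd _), div_self (gaussProd_ne_zero hsub hadd _),
      mul_add_one (n + 1) (n + 1), pow_add q ((n + 1) * (n + 1)), ← sq]
    have hn := hadd (n + 1)
    field_simp
    ring

end Algebra

section Products

lemma one_add_ne_zero_of_norm_lt_one {R : Type*} [NormedRing R] [NormOneClass R] {x : R}
    (hx : ‖x‖ < 1) : 1 + x ≠ 0 := fun h => by
  rw [eq_neg_of_add_eq_zero_right h, norm_neg, norm_one] at hx
  exact lt_irrefl 1 hx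

variable {R : Type*} [NormedCommRing R] {q : R}

lemma summable_norm_pow_pnat (hq : ‖q‖ < 1) : Summable fun k : ℕ+ => ‖q ^ (k : ℕ)‖ :=
  (summable_norm_geometric_of_norm_lt_one hq).comp_injective PNat.coe_injective

variable [NormOneClass R]

lemma one_add_pow_ne_zero (hq : ‖q‖ < 1) {k : ℕ} (hk : k ≠ 0) : 1 + q ^ k ≠ 0 :=
  one_add_ne_zero_of_norm_lt_one
    ((norm_pow_le q k).trans_lt (pow_lt_one₀ (norm_nonneg _) hq hk))

lemma one_sub_pow_ne_zero (hq : ‖q‖ < 1) {k : ℕ} (hk : k ≠ 0) : 1 - q ^ k ≠ 0 := by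
  rw [sub_eq_add_neg]
  refine one_add_ne_zero_of_norm_lt_one ?_
  rw [norm_neg]
  exact (norm_pow_le q k).trans_lt (pow_lt_one₀ (norm_nonneg _) hq hk)

variable [CompleteSpace R]

lemma multipliable_one_add_pow_pnat (hq : ‖q‖ < 1) : Multipliable fun k : ℕ+ => 1 + q ^ (k : ℕ) :=
  multipliable_one_add_of_summable (summable_norm_pow_pnat hq)

lemma multipliable_one_sub_pow_pnat (hq : ‖q‖ < 1) :
    Multipliable fun k : ℕ+ => 1 - q ^ (k : ℕ) := by
  simpa only [sub_eq_add_neg] using multipliable_one_add_of_summable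
    (f := fun k : ℕ+ => -q ^ (k : ℕ)) (by simpa only [norm_neg] using summable_norm_pow_pnat hq)

end Products

variable {𝕜 : Type*} [NormedField 𝕜] [CompleteSpace 𝕜] {q : 𝕜}

lemma tprod_one_add_pow_pnat_ne_zero (hq : ‖q‖ < 1) : ∏' k : ℕ+, (1 + q ^ (k : ℕ)) ≠ 0 :=
  tprod_one_add_ne_zero_of_summable (fun k => one_add_pow_ne_zero hq k.ne_zero)
    (summable_norm_pow_pnat hq)

lemma hasProd_one_div_one_add_pow_pnat (hq : ‖q‖ < 1) :
    HasProd (fun k : ℕ+ => 1 / (1 + q ^ (k : ℕ))) (∏' k : ℕ+, (1 + q ^ (k : ℕ)))⁻¹ := by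
  simpa only [one_div] using
    (multipliable_one_add_pow_pnat hq).hasProd.inv₀ (tprod_one_add_pow_pnat_ne_zero hq)

lemma tprod_one_sub_pow_pnat_ne_zero (hq : ‖q‖ < 1) : ∏' k : ℕ+, (1 - q ^ (k : ℕ)) ≠ 0 := by
  simpa only [sub_eq_add_neg] using tprod_one_add_ne_zero_of_summable
    (f := fun k : ℕ+ => -q ^ (k : ℕ))
    (fun k => by simpa only [sub_eq_add_neg] using one_sub_pow_ne_zero hq k.ne_zero)
    (by simpa only [norm_neg] using summable_norm_pow_pnat hq)

lemma tendsto_gaussProd (hq : ‖q‖ < 1) : Tendsto (gaussProd q) atTop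
    (𝓝 ((∏' k : ℕ+, (1 - q ^ (k : ℕ))) / ∏' k : ℕ+, (1 + q ^ (k : ℕ)))) :=
  ((hasProd_pnat_iff_hasProd_succ (f := fun k => (1 - q ^ k) / (1 + q ^ k))).1
    ((multipliable_one_sub_pow_pnat hq).hasProd.div₀ (multipliable_one_add_pow_pnat hq).hasProd
      (tprod_one_add_pow_pnat_ne_zero hq))).tendsto_prod_nat

lemma exists_norm_shanksTerm_le [NeZero (2 : 𝕜)] (hq : ‖q‖ < 1) :
    ∃ C, ∀ n s, ‖shanksTerm q n (s + 1)‖ ≤ C * ‖q‖ ^ n := by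
  have hlim := tendsto_gaussProd hq
  have hne := div_ne_zero (tprod_one_sub_pow_pnat_ne_zero hq) (tprod_one_add_pow_pnat_ne_zero hq)
  obtain ⟨A, hA⟩ := (Metric.isBounded_range_of_tendsto _ hlim).exists_norm_le
  obtain ⟨B, hB⟩ := (Metric.isBounded_range_of_tendsto _ (hlim.inv₀ hne)).exists_norm_le
  have hdiv : Tendsto (fun s => 2 / (1 + q ^ (s + 1))) atTop (𝓝 (2 / (1 + 0))) :=
    tendsto_const_nhds.div (tendsto_const_nhds.add
      ((tendsto_add_atTop_iff_nat 1).2 (tendsto_pow_atTop_nhds_zero_of_norm_lt_one hq))) (by simp)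
  obtain ⟨D, hD⟩ := (Metric.isBounded_range_of_tendsto _ hdiv).exists_norm_le
  simp only [Set.forall_mem_range] at hA hB hD
  have hA0 : 0 ≤ A := (norm_nonneg _).trans (hA 0)
  have hD0 : 0 ≤ D := (norm_nonneg _).trans (hD 0)
  refine ⟨D * (A * B), fun n s => ?_⟩
  have hpow : ‖q‖ ^ ((s + 1) * (n + 1)) ≤ ‖q‖ ^ n :=
    pow_le_pow_of_le_one (norm_nonneg _) hq.le (by nlinarith)
  calc ‖shanksTerm q n (s + 1)‖
      = ‖2 / (1 + q ^ (s + 1))‖ * ‖q‖ ^ ((s + 1) * (n + 1)) *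
          (‖gaussProd q n‖ * ‖(gaussProd q (s + 1))⁻¹‖) := by
        simp [shanksTerm, div_eq_mul_inv]
    _ ≤ D * ‖q‖ ^ n * (A * B) := by
        gcongr
        exacts [hD s, hA n, hB (s + 1)]
    _ = D * (A * B) * ‖q‖ ^ n := by ring

lemma tendsto_sum_shanksTerm_succ [NeZero (2 : 𝕜)] (hq : ‖q‖ < 1) :
    Tendsto (fun n => ∑ s ∈ range n, shanksTerm q n (s + 1)) atTop (𝓝 0) := by
  obtain ⟨C, hC⟩ := exists_norm_shanksTerm_le hq
  refine squeeze_zero_norm (a := fun n : ℕ => C * (n * ‖q‖ ^ n)) (fun n => ?_) ?_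
  · refine (norm_sum_le_of_le _ fun s _ => hC n s).trans_eq ?_
    rw [sum_const, card_range, nsmul_eq_mul]
    ring
  · simpa using (tendsto_self_mul_const_pow_of_lt_one (norm_nonneg q) hq).const_mul C

lemma summable_neg_one_pow_mul_pow_sq (hq : ‖q‖ < 1) :
    Summable fun n : ℕ => (-1) ^ n * q ^ (n ^ 2) := by
  refine .of_norm_bounded (summable_geometric_of_lt_one (norm_nonneg q) hq) fun n => ?_
  rw [norm_mul, norm_pow, norm_pow, norm_neg, norm_one, one_pow, one_mul]
  exact pow_le_pow_of_le_one (norm_nonneg q) hq.le (Nat.le_self_pow two_ne_zero n)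

lemma summable_neg_one_zpow_mul_zpow_sq (hq : ‖q‖ < 1) :
    Summable fun k : ℤ => (-1) ^ k * q ^ (k ^ 2) := by
  have hnat := summable_neg_one_pow_mul_pow_sq hq
  refine .of_nat_of_neg (mod_cast hnat) ?_
  simp only [even_two.neg_pow, zpow_neg, ← inv_zpow, inv_neg, inv_one]
  exact_mod_cast hnat

lemma tendsto_one_add_two_mul_sum_neg_one_pow_mul_pow_sq [NeZero (2 : 𝕜)] (hq : ‖q‖ < 1) :
    Tendsto (fun n => 1 + 2 * ∑ s ∈ range n, (-1) ^ (s + 1) * q ^ ((s + 1) ^ 2)) atTop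
      (𝓝 ((∏' k : ℕ+, (1 - q ^ (k : ℕ))) / ∏' k : ℕ+, (1 + q ^ (k : ℕ)))) := by
  have hsub : ∀ j, 1 - q ^ (j + 1) ≠ 0 := fun j => one_sub_pow_ne_zero hq j.succ_ne_zero
  have hadd : ∀ j, 1 + q ^ j ≠ 0
    | 0 => by simpa [one_add_one_eq_two] using two_ne_zero
    | j + 1 => one_add_pow_ne_zero hq j.succ_ne_zero
  have hlim := (tendsto_sum_shanksTerm_succ hq).add (tendsto_gaussProd hq)
  rw [zero_add] at hlim
  refine hlim.congr fun n => ?_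
  rw [← sum_shanksTerm hsub hadd, sum_range_succ', shanksTerm_zero hadd]

theorem tsum_neg_one_zpow_mul_zpow_sq [NeZero (2 : 𝕜)] (hq : ‖q‖ < 1) :
    ∑' k : ℤ, (-1) ^ k * q ^ (k ^ 2) =
      (∏' k : ℕ+, (1 - q ^ (k : ℕ))) / ∏' k : ℕ+, (1 + q ^ (k : ℕ)) := by
  have heven : Function.Even fun k : ℤ => (-1) ^ k * q ^ (k ^ 2) := fun k => by
    simp only [even_two.neg_pow, zpow_neg, ← inv_zpow, inv_neg, inv_one]
  have hpnat : ∑' k : ℕ+, (-1) ^ (k : ℤ) * q ^ ((k : ℤ) ^ 2) =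
      ∑' n : ℕ, (-1) ^ (n + 1) * q ^ ((n + 1) ^ 2) := by
    rw [← tsum_pnat_eq_tsum_succ (f := fun n => (-1) ^ n * q ^ (n ^ 2))]
    exact tsum_congr fun k => by norm_cast
  have hsum : Summable fun n : ℕ => (-1) ^ (n + 1) * q ^ ((n + 1) ^ 2) :=
    (summable_neg_one_pow_mul_pow_sq hq).comp_injective (add_left_injective 1)
  calc ∑' k : ℤ, (-1) ^ k * q ^ (k ^ 2)
      = 1 + 2 * ∑' k : ℕ+, (-1) ^ (k : ℤ) * q ^ ((k : ℤ) ^ 2) := by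
        simpa using tsum_int_eq_zero_add_two_mul_tsum_pnat heven
          (summable_neg_one_zpow_mul_zpow_sq hq)
    _ = 1 + 2 * ∑' n : ℕ, (-1) ^ (n + 1) * q ^ ((n + 1) ^ 2) := by rw [hpnat]
    _ = _ := tendsto_nhds_unique ((hsum.hasSum.tendsto_sum_nat.const_mul 2).const_add 1)
        (tendsto_one_add_two_mul_sum_neg_one_pow_mul_pow_sq hq)

end GaussIdentity

lemma tsum_pi_apply_eq_sum {ι α M : Type*} [AddCommMonoid M] [TopologicalSpace M] [T2Space M]
    {f : ι → α → M} {F : α → Finset ι} (hF : ∀ a, ∀ i ∉ F a, f i a = 0) (a : α) :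
    (∑' i, f i) a = ∑ i ∈ F a, f i a :=
  congrFun (HasSum.tsum_eq (Pi.hasSum.2 fun a => hasSum_sum_of_ne_finset_zero (hF a))) a

lemma ofReal_tprod {ι : Type*} {f : ι → ℝ} (hf : Multipliable f) :
    ((∏' i, f i : ℝ) : ℂ) = ∏' i, (f i : ℂ) :=
  hf.map_tprod Complex.ofRealHom Complex.continuous_ofReal

lemma degree_sub_single_one_add_one {ι : Type*} {l : ι →₀ ℕ} {k : ι} (hk : l k ≠ 0) :
    (l - Finsupp.single k 1).degree + 1 = l.degree := by
  conv_rhs => rw [← Finsupp.sub_add_single_one_cancel hk]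
  simp

namespace TorusModel

open Finset

section Spectrum

/-- The level `∑ₖ k nₖ` of the occupation numbers `nₖ`, the eigenvalue of the number operator
`∑ₖ a₋ₖ aₖ`. -/
def level (l : ℕ+ →₀ ℕ) : ℕ := l.sum fun k n => k * n

/-- The contribution of the zero modes and of the Casimir energy `-1/12` to the energy of a state of
momentum `m / R` and winding number `w`, in units of `2π / β`. -/
noncomputable def zeroModeEnergy (R : ℝ) (m w : ℤ) : ℝ := (R * w) ^ 2 + (m / (2 * R)) ^ 2 - 1 / 12

/-- The eigenvalue of the Hamiltonian on a vector of the occupation-number basis, in units of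
`2π / β`. -/
noncomputable def energy (R : ℝ) (s : Label) : ℝ :=
  zeroModeEnergy R s.mom s.wind + level s.left + level s.right

/-- The closed string nome `q̃ = e^{-2π/β}`. -/
noncomputable def nome (β : ℝ) : ℝ := Real.exp (-(2 * Real.pi / β))

lemma nome_pos (β : ℝ) : 0 < nome β := Real.exp_pos _

lemma nome_lt_one {β : ℝ} (hβ : 0 < β) : nome β < 1 :=
  Real.exp_lt_one_iff.2 (neg_neg_of_pos (by positivity))

lemma pow_degree_mul_pow_level {M : Type*} [CommMonoid M] (a b : M) (l : ℕ+ →₀ ℕ) :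
    a ^ l.degree * b ^ level l = l.prod fun k n => (a * b ^ (k : ℕ)) ^ n := by
  simp only [level, Finsupp.sum, Finsupp.prod, Finsupp.degree_apply, ← prod_pow_eq_pow_sum,
    ← prod_mul_distrib, mul_pow, pow_mul]

lemma leftCreate_leftAnnihilate (k : ℕ+) (ψ : FormalState) (s : Label) :
    leftCreate k (leftAnnihilate k ψ) s = (k * s.left k) * ψ s := by
  by_cases h : s.left k = 0
  · simp [leftCreate, h]
  · have hpred : ((s.left k - 1 : ℕ) : ℝ) + 1 = s.left k := by
      exact_mod_cast Nat.sub_add_cancel (Nat.pos_of_ne_zero h)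
    simp only [leftCreate, leftAnnihilate, Finsupp.sub_add_single_one_cancel h, Finsupp.coe_tsub,
      Pi.sub_apply, Finsupp.single_eq_same, hpred]
    rw [← mul_assoc, ← Complex.ofReal_mul, Real.mul_self_sqrt (by positivity)]
    norm_cast

/- Exchanging the two chiral halves turns the left-moving operators into the right-moving ones. -/
lemma rightCreate_rightAnnihilate (k : ℕ+) (ψ : FormalState) (s : Label) :
    rightCreate k (rightAnnihilate k ψ) s = (k * s.right k) * ψ s :=
  leftCreate_leftAnnihilate k (fun t => ψ ⟨t.mom, t.wind, t.right, t.left⟩)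
    ⟨s.mom, s.wind, s.right, s.left⟩

lemma tsum_apply_eq_level_mul {N : ℕ+ → FormalState} {occ : Label → ℕ+ →₀ ℕ} {ψ : FormalState}
    (hN : ∀ k s, N k s = (k * occ s k) * ψ s) (s : Label) :
    (∑' k, N k) s = level (occ s) * ψ s := by
  rw [tsum_pi_apply_eq_sum (F := fun s => (occ s).support) fun s k hk => by
    simp [hN, Finsupp.notMem_support_iff.1 hk]]
  simp [hN, level, Finsupp.sum, sum_mul]

lemma hamiltonian_apply (R β : ℝ) (ψ : FormalState) (s : Label) :
    hamiltonian R β ψ s = (2 * Real.pi / β * energy R s : ℝ) * ψ s := by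
  simp only [hamiltonian, radiusWinding, halfMomentum, Pi.smul_apply, Pi.add_apply, Pi.sub_apply,
    smul_eq_mul, energy, zeroModeEnergy,
    tsum_apply_eq_level_mul fun k => leftCreate_leftAnnihilate k ψ,
    tsum_apply_eq_level_mul fun k => rightCreate_rightAnnihilate k ψ]
  push_cast
  ring

lemma expOp_apply_of_diagonal {A : FormalState → FormalState} {a : Label → ℂ}
    (hA : ∀ ψ s, A ψ s = a s * ψ s) (ψ : FormalState) (s : Label) :
    expOp A ψ s = Complex.exp (a s) * ψ s := by
  have hiter : ∀ (j : ℕ) (s : Label), (A^[j]) ψ s = a s ^ j * ψ s := fun j => by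
    induction j with
    | zero => simp
    | succ j ih =>
      exact fun s => by rw [Function.iterate_succ_apply', hA, ih, pow_succ', mul_assoc]
  have hsum : ∀ s, HasSum (fun j : ℕ => ((j.factorial : ℂ)⁻¹ • (A^[j]) ψ) s)
      (Complex.exp (a s) * ψ s) := fun s => by
    rw [Complex.exp_eq_exp_ℂ]
    refine ((NormedSpace.expSeries_div_hasSum_exp (a s)).mul_right (ψ s)).congr_fun fun j => ?_
    rw [Pi.smul_apply, hiter, smul_eq_mul, div_eq_inv_mul, mul_assoc]
  exact congrFun (HasSum.tsum_eq (Pi.hasSum.2 hsum)) s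

lemma propagator_apply (R β : ℝ) (ψ : FormalState) (s : Label) :
    propagator R β ψ s = (nome β ^ (energy R s / 2) : ℝ) * ψ s := by
  have hdiag : ∀ ψ s, ((-(1 / 2) : ℂ) • hamiltonian R β ψ) s =
      (-(2 * Real.pi / β) * (energy R s / 2) : ℝ) * ψ s := fun ψ s => by
    rw [Pi.smul_apply, hamiltonian_apply, smul_eq_mul]
    push_cast
    ring
  rw [propagator, expOp_apply_of_diagonal hdiag, nome, ← Real.exp_mul, Complex.ofReal_exp]

end Spectrum

section IshibashiStates

/-- The formal state `∑ₗ f(l) |m/R, w; l, l⟩` with equal left and right occupation numbers; the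
Ishibashi states are of this form. -/
def pairedState (m w : ℤ) (f : (ℕ+ →₀ ℕ) → ℂ) : FormalState := fun s =>
  if s.mom = m ∧ s.wind = w ∧ s.left = s.right then f s.left else 0

/-- The Ishibashi state `exp(ε ∑ₖ a₋ₖ ã₋ₖ / k) |p = m/R, w⟩`; the Neumann states have `ε = -1` and
the Dirichlet states `ε = 1`. -/
noncomputable def ishibashi (ε : ℂ) (m w : ℤ) : FormalState :=
  expOp (fun ψ => ε • pairCreate ψ) (ket m w)

lemma neumannState_eq_ishibashi (n : ℤ) : neumannState n = ishibashi (-1) 0 n := by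
  simp only [neumannState, ishibashi, neg_one_smul]

lemma dirichletState_eq_ishibashi (m : ℤ) : dirichletState m = ishibashi 1 m 0 := by
  simp only [dirichletState, ishibashi, one_smul]

lemma pairedState_apply_pair (m w : ℤ) (f : (ℕ+ →₀ ℕ) → ℂ) (l : ℕ+ →₀ ℕ) :
    pairedState m w f ⟨m, w, l, l⟩ = f l :=
  if_pos ⟨rfl, rfl, rfl⟩

lemma smul_pairedState (c : ℂ) (m w : ℤ) (f : (ℕ+ →₀ ℕ) → ℂ) :
    c • pairedState m w f = pairedState m w (c • f) := by
  ext s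
  simp [pairedState]

lemma ket_eq_pairedState (m w : ℤ) : ket m w = pairedState m w (Pi.single 0 1) := by
  classical
  ext s
  rw [ket, pairedState, Pi.single_apply, Pi.single_apply, ← ite_and]
  refine if_congr (Label.ext_iff.trans ⟨?_, ?_⟩) rfl rfl
  · rintro ⟨hm, hw, hl, hr⟩
    exact ⟨⟨hm, hw, hl.trans hr.symm⟩, hl⟩
  · rintro ⟨⟨hm, hw, hlr⟩, hl⟩
    exact ⟨hm, hw, hl, hlr.symm.trans hl⟩

lemma leftCreate_rightCreate_apply (k : ℕ+) (ψ : FormalState) (s : Label) :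
    leftCreate k (rightCreate k ψ) s = k * (√(s.left k * s.right k) : ℝ) *
      ψ ⟨s.mom, s.wind, s.left - Finsupp.single k 1, s.right - Finsupp.single k 1⟩ := by
  have hsqrt : √((k : ℝ) * s.left k) * √((k : ℝ) * s.right k) =
      k * √((s.left k : ℝ) * s.right k) := by
    rw [← Real.sqrt_mul (by positivity), mul_mul_mul_comm, Real.sqrt_mul (by positivity),
      Real.sqrt_mul_self (by positivity)]
  simp only [leftCreate, rightCreate]
  rw [← mul_assoc, ← Complex.ofReal_mul, hsqrt, Complex.ofReal_mul, Complex.ofReal_natCast]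

lemma pairCreate_apply (ψ : FormalState) (s : Label) :
    pairCreate ψ s = ∑ k ∈ s.left.support, (√(s.left k * s.right k) : ℝ) *
      ψ ⟨s.mom, s.wind, s.left - Finsupp.single k 1, s.right - Finsupp.single k 1⟩ := by
  have hterm : ∀ (k : ℕ+) (s : Label), (((k : ℂ)⁻¹) • leftCreate k (rightCreate k ψ)) s =
      (√(s.left k * s.right k) : ℝ) *
        ψ ⟨s.mom, s.wind, s.left - Finsupp.single k 1, s.right - Finsupp.single k 1⟩ :=
    fun k s => by
      rw [Pi.smul_apply, leftCreate_rightCreate_apply, smul_eq_mul, mul_assoc,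
        inv_mul_cancel_left₀ (Nat.cast_ne_zero.2 k.ne_zero)]
  rw [pairCreate, tsum_pi_apply_eq_sum (F := fun s => s.left.support) fun s k hk => by
    simp [hterm, Finsupp.notMem_support_iff.1 hk]]
  simp only [hterm]

lemma pairCreate_pairedState (m w : ℤ) (f : (ℕ+ →₀ ℕ) → ℂ) :
    pairCreate (pairedState m w f) =
      pairedState m w fun l => ∑ k ∈ l.support, l k * f (l - Finsupp.single k 1) := by
  ext ⟨m', w', l, r⟩
  rw [pairCreate_apply]
  simp only [pairedState]
  by_cases hlr : l = r
  · subst hlr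
    by_cases h : m' = m ∧ w' = w <;> simp [h, Real.sqrt_mul_self]
  · rw [if_neg fun h => hlr h.2.2]
    refine sum_eq_zero fun k hk => ?_
    by_cases hr : r k = 0
    · simp [hr]
    · refine mul_eq_zero_of_right _ (if_neg fun h => hlr ?_)
      rw [← Finsupp.sub_add_single_one_cancel (Finsupp.mem_support_iff.1 hk), h.2.2,
        Finsupp.sub_add_single_one_cancel hr]

lemma iterate_smul_pairCreate_ket (ε : ℂ) (m w : ℤ) (j : ℕ) :
    (fun ψ => ε • pairCreate ψ)^[j] (ket m w) =
      pairedState m w fun l => if l.degree = j then ε ^ j * j.factorial else 0 := by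
  induction j with
  | zero =>
    rw [Function.iterate_zero, id, ket_eq_pairedState]
    congr 1
    ext l
    simp [Pi.single_apply, Finsupp.degree_eq_zero_iff]
  | succ j ih =>
    rw [Function.iterate_succ_apply', ih, pairCreate_pairedState, smul_pairedState]
    congr 1
    ext l
    have hstep : ∀ k ∈ l.support, ((l - Finsupp.single k 1).degree = j ↔ l.degree = j + 1) :=
      fun k hk => by
        rw [← degree_sub_single_one_add_one (Finsupp.mem_support_iff.1 hk), add_left_inj]
    have hsum : ∑ k ∈ l.support, (l k : ℂ) = l.degree := by
      rw [Finsupp.degree_apply, Nat.cast_sum]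
    rw [Pi.smul_apply, smul_eq_mul,
      sum_congr rfl fun k hk => by rw [if_congr (hstep k hk) rfl rfl], ← sum_mul, hsum]
    split_ifs with hj
    · rw [hj, Nat.factorial_succ]
      push_cast
      ring
    · rw [mul_zero, mul_zero]

lemma ishibashi_eq_pairedState (ε : ℂ) (m w : ℤ) :
    ishibashi ε m w = pairedState m w fun l => ε ^ l.degree := by
  ext s
  simp only [ishibashi, expOp, iterate_smul_pairCreate_ket, smul_pairedState]
  rw [tsum_pi_apply_eq_sum (F := fun s => {s.left.degree}) fun s j hj => ?_]
  · have hfact : (s.left.degree.factorial : ℂ) ≠ 0 := mod_cast s.left.degree.factorial_ne_zero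
    simp only [sum_singleton, pairedState, Pi.smul_apply, smul_eq_mul, if_true]
    rw [mul_comm, mul_inv_cancel_right₀ hfact]
  · have : s.left.degree ≠ j := fun h => hj (mem_singleton.2 h.symm)
    simp [pairedState, this]

end IshibashiStates

section MatrixElements

lemma propagator_apply_pair (R β : ℝ) (ψ : FormalState) (m w : ℤ) (l : ℕ+ →₀ ℕ) :
    propagator R β ψ ⟨m, w, l, l⟩ =
      (nome β ^ (zeroModeEnergy R m w / 2) : ℝ) * ((nome β : ℂ) ^ level l * ψ ⟨m, w, l, l⟩) := by
  have henergy : energy R ⟨m, w, l, l⟩ / 2 = zeroModeEnergy R m w / 2 + level l := by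
    rw [energy]
    ring
  rw [propagator_apply, henergy, Real.rpow_add_natCast (nome_pos β).ne', Complex.ofReal_mul,
    Complex.ofReal_pow, mul_assoc]

lemma hasMatrixElement_pairedState (R β : ℝ) (m w : ℤ) {f g : (ℕ+ →₀ ℕ) → ℂ} {z : ℂ}
    (hz : HasSum (fun l => conj (f l) * g l * (nome β : ℂ) ^ level l) z) :
    HasMatrixElement (pairedState m w f) (propagator R β) (pairedState m w g)
      ((nome β ^ (zeroModeEnergy R m w / 2) : ℝ) * z) := by
  have hinj : Function.Injective fun l : ℕ+ →₀ ℕ => (⟨m, w, l, l⟩ : Label) :=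
    fun _ _ h => congrArg Label.left h
  rw [HasMatrixElement, ← hinj.hasSum_iff]
  · refine (hz.mul_left _).congr_fun fun l => ?_
    simp only [Function.comp_apply, propagator_apply_pair, pairedState_apply_pair]
    ring
  · rintro ⟨m', w', l, r⟩ hs
    rw [pairedState, if_neg, map_zero, zero_mul]
    rintro ⟨rfl, rfl, hlr⟩
    exact hs ⟨l, Label.ext rfl rfl rfl hlr⟩

lemma hasMatrixElement_pairedState_of_ne (R β : ℝ) {m w m' w' : ℤ} (h : ¬(m = m' ∧ w = w'))
    (f g : (ℕ+ →₀ ℕ) → ℂ) :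
    HasMatrixElement (pairedState m w f) (propagator R β) (pairedState m' w' g) 0 := by
  refine hasSum_zero.congr_fun fun s => ?_
  rw [propagator_apply, pairedState, pairedState]
  split_ifs with hs hs'
  · exact absurd ⟨hs.1.symm.trans hs'.1, hs.2.1.symm.trans hs'.2.1⟩ h
  all_goals simp

theorem hasMatrixElement_ishibashi (R : ℝ) {β : ℝ} (hβ : 0 < β) {ε δ : ℂ}
    (hεδ : ‖conj ε * δ‖ * nome β < 1) (m w m' w' : ℤ) :
    HasMatrixElement (ishibashi ε m w) (propagator R β) (ishibashi δ m' w')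
      (if m = m' ∧ w = w' then (nome β ^ (zeroModeEnergy R m w / 2) : ℝ) *
        (∏' k : ℕ+, (1 - conj ε * δ * (nome β : ℂ) ^ (k : ℕ)))⁻¹ else 0) := by
  rw [ishibashi_eq_pairedState, ishibashi_eq_pairedState]
  split_ifs with h
  · obtain ⟨rfl, rfl⟩ := h
    have hnorm : ‖(nome β : ℂ)‖ = nome β := Complex.norm_of_nonneg (nome_pos β).le
    have hlt : ∀ k : ℕ+, ‖conj ε * δ * (nome β : ℂ) ^ (k : ℕ)‖ < 1 := fun k => by
      rw [norm_mul, norm_pow, hnorm]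
      refine lt_of_le_of_lt ?_ hεδ
      gcongr
      exact pow_le_of_le_one (nome_pos β).le (nome_lt_one hβ).le k.ne_zero
    have hsummable : Summable fun k : ℕ+ => ‖conj ε * δ * (nome β : ℂ) ^ (k : ℕ)‖ := by
      simp_rw [norm_mul _ (_ ^ _)]
      exact (summable_norm_pow_pnat (hnorm.trans_lt (nome_lt_one hβ))).mul_left _
    refine hasMatrixElement_pairedState R β m w
      ((hasSum_finsupp_prod_pow hlt hsummable).congr_fun fun l => ?_)
    rw [map_pow, ← mul_pow, pow_degree_mul_pow_level]
  · exact hasMatrixElement_pairedState_of_ne R β h _ _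

end MatrixElements

section ClosedForms

variable {q : ℝ}

lemma etaNome_eq (hq : 0 < q) :
    etaNome q = (q ^ (1 / 24 : ℝ) : ℝ) * ∏' k : ℕ+, (1 - (q : ℂ) ^ (k : ℕ)) := by
  have hperiod : (2 * Real.pi * Complex.I : ℂ) ≠ 0 := Complex.two_pi_I_ne_zero
  rw [etaNome, ModularForm.eta, tprod_pnat_eq_tprod_succ (f := fun n => 1 - (q : ℂ) ^ n)]
  simp only [ModularForm.eta_q_eq_pow, mul_div_cancel₀ _ hperiod,
    Complex.exp_log (Complex.ofReal_ne_zero.2 hq.ne')]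
  rw [Function.Periodic.qParam, mul_div_cancel₀ _ hperiod, Real.rpow_def_of_pos hq,
    Complex.ofReal_exp]
  congr 2
  push_cast [Complex.ofReal_log hq.le]
  ring

lemma etaNome_ne_zero (h0 : 0 < q) (h1 : q < 1) : etaNome q ≠ 0 := by
  rw [etaNome_eq h0]
  exact mul_ne_zero (Complex.ofReal_ne_zero.2 (Real.rpow_pos_of_pos h0 _).ne')
    (tprod_one_sub_pow_pnat_ne_zero (by rwa [Complex.norm_of_nonneg h0.le]))

lemma rpow_sub_mul_inv_tprod_eq_div_etaNome (hq : 0 < q) (c : ℝ) :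
    (q ^ (c - 1 / 24) : ℝ) * (∏' k : ℕ+, (1 - (q : ℂ) ^ (k : ℕ)))⁻¹ =
      (q ^ c : ℝ) / etaNome q := by
  rw [etaNome_eq hq, Real.rpow_sub hq, Complex.ofReal_div, ← div_eq_mul_inv, div_div]

lemma ofReal_rpow_mul_tprod_one_div_one_add (h0 : 0 < q) (h1 : q < 1) (c : ℝ) :
    ((q ^ c * ∏' k : ℕ+, 1 / (1 + q ^ (k : ℕ)) : ℝ) : ℂ) =
      (q ^ c : ℝ) * (∏' k : ℕ+, (1 + (q : ℂ) ^ (k : ℕ)))⁻¹ := by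
  have hnorm : ‖(q : ℂ)‖ < 1 := by rwa [Complex.norm_of_nonneg h0.le]
  have hmult : Multipliable fun k : ℕ+ => 1 / (1 + q ^ (k : ℕ)) :=
    (hasProd_one_div_one_add_pow_pnat (by rwa [Real.norm_of_nonneg h0.le])).multipliable
  rw [Complex.ofReal_mul, ofReal_tprod hmult, ← (hasProd_one_div_one_add_pow_pnat hnorm).tprod_eq]
  push_cast
  rfl

theorem rpow_mul_tprod_one_div_one_add_eq_theta_div_etaNome (h0 : 0 < q) (h1 : q < 1) :
    ((q ^ (-(1 / 24) : ℝ) * ∏' k : ℕ+, 1 / (1 + q ^ (k : ℕ)) : ℝ) : ℂ) =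
      ((∑' k : ℤ, (-1 : ℝ) ^ k * q ^ (k ^ 2) : ℝ) : ℂ) / etaNome q := by
  have hnorm : ‖(q : ℂ)‖ < 1 := by rwa [Complex.norm_of_nonneg h0.le]
  have hprod := tprod_one_sub_pow_pnat_ne_zero hnorm
  rw [ofReal_rpow_mul_tprod_one_div_one_add h0 h1, Complex.ofReal_tsum, etaNome_eq h0,
    Real.rpow_neg h0.le]
  push_cast
  rw [tsum_neg_one_zpow_mul_zpow_sq hnorm]
  field_simp

theorem hasMatrixElement_neumann_neumann (R : ℝ) {β : ℝ} (hβ : 0 < β) (n m : ℤ) :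
    HasMatrixElement (neumannState n) (propagator R β) (neumannState m)
      (if n = m then ((nome β ^ (R ^ 2 * (n : ℝ) ^ 2 / 2) : ℝ) : ℂ) / etaNome (nome β) else 0) := by
  have henergy : zeroModeEnergy R 0 n / 2 = R ^ 2 * n ^ 2 / 2 - 1 / 24 := by
    simp only [zeroModeEnergy, Int.cast_zero]
    ring
  rw [neumannState_eq_ishibashi, neumannState_eq_ishibashi,
    ← rpow_sub_mul_inv_tprod_eq_div_etaNome (nome_pos β), ← henergy]
  simpa using hasMatrixElement_ishibashi R hβ (ε := -1) (δ := -1)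
    (by simpa using nome_lt_one hβ) 0 n 0 m

theorem hasMatrixElement_dirichlet_dirichlet (R : ℝ) {β : ℝ} (hβ : 0 < β) (n m : ℤ) :
    HasMatrixElement (dirichletState n) (propagator R β) (dirichletState m)
      (if n = m then
        ((nome β ^ ((n : ℝ) ^ 2 / (8 * R ^ 2)) : ℝ) : ℂ) / etaNome (nome β) else 0) := by
  have henergy : zeroModeEnergy R n 0 / 2 = n ^ 2 / (8 * R ^ 2) - 1 / 24 := by
    simp only [zeroModeEnergy, Int.cast_zero]
    ring
  rw [dirichletState_eq_ishibashi, dirichletState_eq_ishibashi,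
    ← rpow_sub_mul_inv_tprod_eq_div_etaNome (nome_pos β), ← henergy]
  simpa using hasMatrixElement_ishibashi R hβ (ε := 1) (δ := 1)
    (by simpa using nome_lt_one hβ) n 0 m 0

theorem hasMatrixElement_neumann_dirichlet (R : ℝ) {β : ℝ} (hβ : 0 < β) (n m : ℤ) :
    HasMatrixElement (neumannState n) (propagator R β) (dirichletState m)
      (if n = 0 ∧ m = 0 then
        ((nome β ^ (-(1 / 24) : ℝ) * ∏' k : ℕ+, 1 / (1 + nome β ^ (k : ℕ)) : ℝ) : ℂ) else 0) := by
  rw [neumannState_eq_ishibashi, dirichletState_eq_ishibashi,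
    ofReal_rpow_mul_tprod_one_div_one_add (nome_pos β) (nome_lt_one hβ)]
  convert hasMatrixElement_ishibashi R hβ (ε := -1) (δ := 1)
    (by simpa using nome_lt_one hβ) 0 n m 0 using 1
  refine ite_congr ?_ ?_ fun _ => rfl
  · rw [and_comm, eq_comm (a := m)]
  · rintro ⟨rfl, rfl⟩
    have henergy : zeroModeEnergy R 0 0 / 2 = -(1 / 24) := by norm_num [zeroModeEnergy]
    simp [henergy]

end ClosedForms

end TorusModel

theorem lemma1 (R β : ℝ) (hR : 0 < R) (hβ : 0 < β) (q : ℝ)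
    (hq : q = Real.exp (-(2 * Real.pi / β))) :
    (∀ n m : ℤ, TorusModel.HasMatrixElement
      (TorusModel.neumannState n) (TorusModel.propagator R β) (TorusModel.neumannState m)
      (if n = m then ((q ^ (R ^ 2 * (n : ℝ) ^ 2 / 2) : ℝ) : ℂ) / TorusModel.etaNome q else 0)) ∧
    (∀ n m : ℤ, TorusModel.HasMatrixElement
      (TorusModel.dirichletState n) (TorusModel.propagator R β) (TorusModel.dirichletState m)
      (if n = m then ((q ^ ((n : ℝ) ^ 2 / (8 * R ^ 2)) : ℝ) : ℂ) / TorusModel.etaNome q else 0)) ∧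
    (∀ n m : ℤ, TorusModel.HasMatrixElement
      (TorusModel.neumannState n) (TorusModel.propagator R β) (TorusModel.dirichletState m)
      (if n = 0 ∧ m = 0 then
        ((q ^ (-(1 / 24) : ℝ) * ∏' k : ℕ+, 1 / (1 + q ^ (k : ℕ)) : ℝ) : ℂ) else 0)) ∧
    Multipliable (fun k : ℕ+ => 1 / (1 + q ^ (k : ℕ))) ∧
    Summable (fun k : ℤ => (-1 : ℝ) ^ k * q ^ (k ^ 2)) ∧
    TorusModel.etaNome q ≠ 0 ∧
    ((q ^ (-(1 / 24) : ℝ) * ∏' k : ℕ+, 1 / (1 + q ^ (k : ℕ)) : ℝ) : ℂ) =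
      ((∑' k : ℤ, (-1 : ℝ) ^ k * q ^ (k ^ 2) : ℝ) : ℂ) / TorusModel.etaNome q := by
  obtain rfl : q = TorusModel.nome β := hq
  have h0 := TorusModel.nome_pos β
  have h1 := TorusModel.nome_lt_one hβ
  have hnorm : ‖TorusModel.nome β‖ < 1 := by rwa [Real.norm_of_nonneg h0.le]
  exact ⟨TorusModel.hasMatrixElement_neumann_neumann R hβ,
    TorusModel.hasMatrixElement_dirichlet_dirichlet R hβ,
    TorusModel.hasMatrixElement_neumann_dirichlet R hβ,
    (hasProd_one_div_one_add_pow_pnat hnorm).multipliable,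
    summable_neg_one_zpow_mul_zpow_sq hnorm,
    TorusModel.etaNome_ne_zero h0 h1,
    TorusModel.rpow_mul_tprod_one_div_one_add_eq_theta_div_etaNome h0 h1⟩
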